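/- \textbf{Definitions.} A simplicial complex $\Delta$ in $\mathbb{R}^n$ is a \emph{triangulation} of a finite full-dimensional set $P\subset\mathbb{R}^n$ if it is pure of dimension $n$, its set of vertices is $P$, and the union of its simplices is $\mathrm{conv}(P)$; it is \emph{Delaunay} if for every $n$-simplex of $\Delta$ the open ball bounded by its circumscribed sphere contains no point of $P$. A \emph{bounding set} $B=\langle n,P,L,U\rangle$ consists of $n\in\mathbb{N}$, a finite full-dimensional set $P\subset\mathbb{R}^n$, and functions $L,U:P\to\mathbb{R}$ with $L\le U$; its \emph{domain} is $\mathrm{dom}(B)=\mathrm{conv}(P)$. For a Delaunay triangulation $\Delta$ of $P$ put \[ \mathcal{E}(B,\Delta)=\bigcup_{S}\mathrm{conv}\bigl(\{(p,L(p)) : p\in\mathrm{vert}(S)\}\cup\{(p,U(p)) : p\in\mathrm{vert}(S)\}\bigr)\subset\mathbb{R}^{n+1}, \] where $S$ runs over the $n$-simplices of $\Delta$. A function $f:D\to\mathbb{R}$ with $\mathrm{dom}(B)\subseteq D\subseteq\mathbb{R}^n$ is \emph{enclosed} by $B$ if $(x,f(x))\in\mathcal{E}(B,\Delta)$ for every $x\in\mathrm{dom}(B)$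 and every Delaunay triangulation $\Delta$ of $P$. A \emph{grid} is a product $P=P_1\times\dots\times P_n$ of finite sets $P_i\subset\mathbb{R}$ with at least two elements each. For a grid $P$ and $q\in\mathrm{conv}(P)$ let $P+q=\prod_i(P_i\cup\{q_i\})$. For a Delaunay triangulation $\Delta$ of $P$ and $g:P\to\mathbb{R}$ define $g+_\Delta q:P+q\to\mathbb{R}$ as follows: if $x\in P+q$ has $x_i=q_i$ for some $i$, then $(g+_\Delta q)(x)=\sum_{v\in\mathrm{vert}(S)}\theta_v\,g(v)$, where $S$ is an $n$-simplex of $\Delta$ containing $x$ and $x=\sum_{v\in\mathrm{vert}(S)}\theta_v v$ is the expression of $x$ as a convex combination of the vertices of $S$; otherwise $x\in P$ and $(g+_\Delta q)(x)=g(x)$. (The value does not depend on the choice of $S$.) For a bounding set $B=\langle n,P,L,U\rangle$ over a grid $P$ let $B+_\Delta q=\langle n,\,P+q,\,L+_\Delta q,\,U+_\Delta q\rangle$. \textbf{Theorem.} Let $B=\langle n,P,L,U\rangle$ be a bounding set over a grid $P$ that encloses a function $f$. Then for every Delaunay triangulation $\Delta$ of $P$ and every point $q\in\mathrm{dom}(B)$,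 the bounding set $B+_\Delta q$ also encloses $f$. -/

import Mathlib

noncomputable section

namespace PolyEnc

open Geometry

/-- `ℝⁿ` with its Euclidean metric. -/
abbrev Pt (n : ℕ) : Type := EuclideanSpace ℝ (Fin n)

/-! ### Triangulations and the Delaunay condition

A simplex is given by the finite set of its vertices; the simplex itself is the convex hull. -/

/-- The closed ball with centre `c` and radius `r` contains the simplex with vertex set `s`, while
no vertex lies in the open ball. -/
def Circumscribes {n : ℕ} (s : Finset (Pt n)) (c : Pt n) (r : ℝ) : Prop :=
  convexHull ℝ (s : Set (Pt n)) ⊆ Metric.closedBall c r ∧ Disjoint (Metric.ball c r) (s : Set (Pt n))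

/-- The ball with centre `c` and radius `r` is the smallest ball circumscribing `s`. -/
def IsCircumball {n : ℕ} (s : Finset (Pt n)) (c : Pt n) (r : ℝ) : Prop :=
  Circumscribes s c r ∧ ∀ c' r', Circumscribes s c' r' → r ≤ r'

/-- The `n`-simplex with vertex set `s` satisfies the Delaunay condition with respect to `P`: the
open circumscribing ball contains no point of `P`. -/
def IsDelaunaySimplex {n : ℕ} (P s : Finset (Pt n)) : Prop :=
  ∃ c r, IsCircumball s c r ∧ Disjoint (Metric.ball c r) (P : Set (Pt n))

/-- The vertex sets of the `n`-simplices of a complex in `ℝⁿ`. -/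
def topSimplices {n : ℕ} (Δ : SimplicialComplex ℝ (Pt n)) : Set (Finset (Pt n)) :=
  {s | s ∈ Δ.faces ∧ s.card = n + 1}

/-- `Δ` is a triangulation of `P`: a pure simplicial `n`-complex whose set of vertices is `P` and
whose simplices cover exactly the convex hull of `P`. -/
structure IsTriangulation {n : ℕ} (P : Finset (Pt n)) (Δ : SimplicialComplex ℝ (Pt n)) : Prop where
  exists_top : (topSimplices Δ).Nonempty
  pure : ∀ s ∈ Δ.faces, ∃ t ∈ topSimplices Δ, s ⊆ t
  vertices_eq : (⋃ s ∈ Δ.faces, (s : Set (Pt n))) = (P : Set (Pt n))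
  space_eq : Δ.space = convexHull ℝ (P : Set (Pt n))

/-- `Δ` is a Delaunay triangulation of `P`. -/
structure IsDelaunayTriangulation {n : ℕ} (P : Finset (Pt n)) (Δ : SimplicialComplex ℝ (Pt n)) :
    Prop extends IsTriangulation P Δ where
  delaunay : ∀ s ∈ topSimplices Δ, IsDelaunaySimplex P s

/-! ### Bounding sets -/

/-- A bounding set `⟨n, P, L, U⟩`. Only the values of `L` and `U` on `P` matter. -/
structure BoundingSet (n : ℕ) where
  points : Finset (Pt n)
  fullDim : affineSpan ℝ (points : Set (Pt n)) = ⊤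
  L : Pt n → ℝ
  U : Pt n → ℝ
  L_le_U : ∀ p ∈ points, L p ≤ U p

/-- The domain of a bounding set. -/
def BoundingSet.dom {n : ℕ} (B : BoundingSet n) : Set (Pt n) :=
  convexHull ℝ (B.points : Set (Pt n))

/-- The polyhedron in `ℝⁿ × ℝ` formed by the restriction of a bounding set to the vertex set `s`:
the convex hull of the points `(p, L p)` and `(p, U p)` with `p ∈ s`. -/
def BoundingSet.polyhedron {n : ℕ} (B : BoundingSet n) (s : Finset (Pt n)) : Set (Pt n × ℝ) :=
  convexHull ℝ ((fun p => (p, B.L p)) '' (s : Set (Pt n)) ∪ (fun p => (p, B.U p)) '' (s : Set (Pt n)))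

/-- The polyhedral enclosure formed by `B` and `Δ`. -/
def BoundingSet.enclosure {n : ℕ} (B : BoundingSet n) (Δ : SimplicialComplex ℝ (Pt n)) :
    Set (Pt n × ℝ) :=
  ⋃ s ∈ topSimplices Δ, B.polyhedron s

/-- `B` encloses the function `f : D → ℝ`, where `dom B ⊆ D`. -/
def BoundingSet.Encloses {n : ℕ} (B : BoundingSet n) {D : Set (Pt n)} (f : D → ℝ) : Prop :=
  ∃ hD : B.dom ⊆ D, ∀ (x : Pt n) (hx : x ∈ B.dom) (Δ : SimplicialComplex ℝ (Pt n)),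
    IsDelaunayTriangulation B.points Δ → (x, f ⟨x, hD hx⟩) ∈ B.enclosure Δ

/-! ### Grids -/

/-- `P` is the Cartesian product of `n` finite sets of reals, each with at least two elements. -/
def IsGrid {n : ℕ} (P : Finset (Pt n)) : Prop :=
  ∃ G : Fin n → Finset ℝ, (∀ i, 2 ≤ (G i).card) ∧ ∀ x : Pt n, x ∈ P ↔ ∀ i, x i ∈ G i

/-- The projection of `P` onto coordinate `i`. -/
def proj {n : ℕ} (P : Finset (Pt n)) (i : Fin n) : Finset ℝ :=
  P.image fun p => p i

/-- `P + q`: the product of the sets `Pᵢ ∪ {qᵢ}`. -/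
def gridExpand {n : ℕ} (P : Finset (Pt n)) (q : Pt n) : Finset (Pt n) :=
  (Fintype.piFinset fun i => insert (q i) (proj P i)).image (WithLp.toLp 2)

theorem mem_gridExpand {n : ℕ} {P : Finset (Pt n)} {q x : Pt n} :
    x ∈ gridExpand P q ↔ ∀ i, x i = q i ∨ x i ∈ proj P i := by
  simp only [gridExpand, Finset.mem_image, Fintype.mem_piFinset, Finset.mem_insert]
  constructor
  · rintro ⟨y, hy, rfl⟩
    exact hy
  · intro h
    exact ⟨x.ofLp, h, rfl⟩

theorem subset_gridExpand {n : ℕ} (P : Finset (Pt n)) (q : Pt n) : P ⊆ gridExpand P q :=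
  fun _ hp => mem_gridExpand.2 fun _ => Or.inr (Finset.mem_image_of_mem _ hp)

/-- The star of `g` in `G`: the points of `G` that share a coordinate with `g`. -/
def star {n : ℕ} (G : Finset (Pt n)) (g : Pt n) : Set (Pt n) :=
  {p | p ∈ G ∧ ∃ i, p i = g i}

/-! ### Interpolation -/

/-- The pair `c = (s, θ)` consists of the vertex set `s` of an `n`-simplex of `Δ` that contains `x`
and of the coefficients `θ` of `x` as a convex combination of `s`. -/
def IsConvexCoords {n : ℕ} (Δ : SimplicialComplex ℝ (Pt n)) (x : Pt n)
    (c : Finset (Pt n) × (Pt n → ℝ)) : Prop :=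
  c.1 ∈ topSimplices Δ ∧ (∀ v ∈ c.1, 0 ≤ c.2 v) ∧ ∑ v ∈ c.1, c.2 v = 1 ∧ ∑ v ∈ c.1, c.2 v • v = x

open Classical in
/-- The barycentric interpolation at `x` of the values of `g` at the vertices of an `n`-simplex of
`Δ` containing `x`. If several `n`-simplices contain `x`, they give the same value, and one of them
is chosen. (The value `0` is used only where no simplex contains `x`.) -/
def interpolate {n : ℕ} (Δ : SimplicialComplex ℝ (Pt n)) (g : Pt n → ℝ) (x : Pt n) : ℝ :=
  if h : ∃ c, IsConvexCoords Δ x c then ∑ v ∈ h.choose.1, h.choose.2 v * g v else 0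

open Classical in
/-- `g` interpolated by `q` using `Δ`, as a function on `P + q`. -/
def interpFun {n : ℕ} (P : Finset (Pt n)) (Δ : SimplicialComplex ℝ (Pt n)) (g : Pt n → ℝ)
    (q x : Pt n) : ℝ :=
  if x ∈ star (gridExpand P q) q then interpolate Δ g x else g x

theorem interpFun_le {n : ℕ} (B : BoundingSet n) (hB : IsGrid B.points)
    {Δ : SimplicialComplex ℝ (Pt n)} (hΔ : IsDelaunayTriangulation B.points Δ) (q x : Pt n)
    (hx : x ∈ gridExpand B.points q) :
    interpFun B.points Δ B.L q x ≤ interpFun B.points Δ B.U q x := by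
  unfold interpFun
  split_ifs with h
  · unfold interpolate
    split_ifs with h'
    · refine Finset.sum_le_sum fun v hv => ?_
      have hv' : v ∈ (B.points : Set (Pt n)) := by
        rw [← hΔ.vertices_eq]
        exact Set.mem_biUnion h'.choose_spec.1.1 hv
      exact mul_le_mul_of_nonneg_left (B.L_le_U v hv') (h'.choose_spec.2.1 v hv)
    · exact le_rfl
  · obtain ⟨G, -, hG⟩ := hB
    refine B.L_le_U x ((hG x).2 fun i => ?_)
    rcases mem_gridExpand.1 hx i with hi | hi
    · exact absurd ⟨hx, i, hi⟩ h
    · obtain ⟨p, hp, hpx⟩ := Finset.mem_image.1 hi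
      exact hpx ▸ (hG p).1 hp i

/-- The interpolated bounding set `B +_Δ q`. -/
def BoundingSet.interp {n : ℕ} (B : BoundingSet n) (hB : IsGrid B.points)
    (Δ : SimplicialComplex ℝ (Pt n)) (hΔ : IsDelaunayTriangulation B.points Δ) (q : Pt n) :
    BoundingSet n where
  points := gridExpand B.points q
  fullDim := by
    rw [eq_top_iff, ← B.fullDim]
    exact affineSpan_mono ℝ (Finset.coe_subset.2 (subset_gridExpand B.points q))
  L := interpFun B.points Δ B.L q
  U := interpFun B.points Δ B.U q
  L_le_U := interpFun_le B hB hΔ q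

end PolyEnc

end

noncomputable section

namespace PolyEnc

open Geometry Topology Filter

/-! ### Affine minorants and their contact sets -/

section Minorants

variable {E : Type*} [NormedAddCommGroup E] [NormedSpace ℝ E]

/-! Lift `P` to the paraboloid `‖x‖²`. Delaunay simplices are those whose lifts lie on lower faces
of the lifted set, so Delaunay triangulations differ only in how they split faces with cospherical
vertices.

In a simplex of `P + q` containing `x`, the refined upper value at `x` unfolds into `∑ m v * U v`,
where `m` is a system of convex weights on `P` representing `x`. Interpolation in `Δ` uses weights
of least paraboloid height (`exists_weights_interpFun`), and a Delaunay simplex of `P + q` stays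
inside one cell of the grid, over which the lower envelope is affine
(`exists_minorant_of_isDelaunaySimplex_gridExpand`). Hence `m` itself has least paraboloid height
among all representations of `x`.

Perturbing the paraboloid by a small multiple of `U`, and then generically, gives a Delaunay
triangulation of `P` whose interpolation of `U` at `x` exceeds that of no such `m` by more than `δ`
(`exists_delaunay_interpolation_le`). As `f x` is bounded by the interpolation of `U` in every
Delaunay triangulation of `P`, letting `δ` tend to zero gives the upper bound
(`le_sum_mul_interpFun`). The lower bound is the same statement for `-L`. -/

theorem affineMap_sum_smul (ℓ : E →ᵃ[ℝ] ℝ) {s : Finset E} {a : E → ℝ} (ha : ∑ v ∈ s, a v = 1) :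
    ℓ (∑ v ∈ s, a v • v) = ∑ v ∈ s, a v * ℓ v := by
  rw [AffineMap.decomp ℓ]
  simp only [map_sum, map_smul, smul_eq_mul, mul_add,
    Finset.sum_add_distrib, Pi.add_apply, ← Finset.sum_mul, ha, one_mul]

theorem affineMap_le_of_mem_convexHull {T : Set E} {ℓ ℓ' : E →ᵃ[ℝ] ℝ} (h : ∀ p ∈ T, ℓ p ≤ ℓ' p)
    {x : E} (hx : x ∈ convexHull ℝ T) : ℓ x ≤ ℓ' x := by
  have hconv : Convex ℝ ((ℓ - ℓ') ⁻¹' Set.Iic 0) := (convex_Iic 0).affine_preimage (ℓ - ℓ')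
  have := convexHull_min (fun p hp => by simpa using h p hp) hconv hx
  simpa using this

/-- The affine function `ℓ` lies below `ω` on `P`. -/
def IsMinorant (P : Finset E) (ω : E → ℝ) (ℓ : E →ᵃ[ℝ] ℝ) : Prop :=
  ∀ p ∈ P, ℓ p ≤ ω p

open Classical in
/-- The points of `P` at which `ℓ` agrees with `ω`. -/
def contact (P : Finset E) (ω : E → ℝ) (ℓ : E →ᵃ[ℝ] ℝ) : Finset E :=
  P.filter fun p => ℓ p = ω p

theorem mem_contact {P : Finset E} {ω : E → ℝ} {ℓ : E →ᵃ[ℝ] ℝ} {p : E} :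
    p ∈ contact P ω ℓ ↔ p ∈ P ∧ ℓ p = ω p := by
  simp [contact]

theorem contact_subset (P : Finset E) (ω : E → ℝ) (ℓ : E →ᵃ[ℝ] ℝ) : contact P ω ℓ ⊆ P :=
  fun _ hp => (mem_contact.1 hp).1

/-- The ratio test of linear programming: `ℓ` is tilted along `h`, which keeps the old contacts,
until the first new point of `P` is touched. -/
theorem exists_contact_ssubset {P : Finset E} {ω : E → ℝ} {ℓ : E →ᵃ[ℝ] ℝ}
    (hℓ : IsMinorant P ω ℓ) (h : E →ᵃ[ℝ] ℝ) (h0 : ∀ p ∈ contact P ω ℓ, h p = 0)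
    (hpos : ∃ p ∈ P, 0 < h p) :
    ∃ τ : ℝ, 0 ≤ τ ∧ IsMinorant P ω (ℓ + τ • h) ∧
      contact P ω ℓ ⊂ contact P ω (ℓ + τ • h) := by
  classical
  obtain ⟨p₀, hp₀, hp₀'⟩ := hpos
  obtain ⟨m, hm, hmin⟩ := Finset.exists_min_image (P.filter fun p => 0 < h p)
    (fun p => (ω p - ℓ p) / h p) ⟨p₀, by simp [hp₀, hp₀']⟩
  simp only [Finset.mem_filter] at hm hmin
  have hτ : 0 ≤ (ω m - ℓ m) / h m := div_nonneg (sub_nonneg.2 (hℓ m hm.1)) hm.2.le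
  refine ⟨(ω m - ℓ m) / h m, hτ, fun p hp => ?_, Finset.ssubset_iff.2 ⟨m, ?_, ?_⟩⟩
  · simp only [AffineMap.coe_add, AffineMap.coe_smul, Pi.add_apply, Pi.smul_apply, smul_eq_mul]
    rcases le_or_gt (h p) 0 with hp' | hp'
    · linarith [hℓ p hp, mul_nonpos_of_nonneg_of_nonpos hτ hp']
    · linarith [(le_div_iff₀ hp').1 (hmin p ⟨hp, hp'⟩)]
  · intro hm'
    exact hm.2.ne' (h0 m hm')
  · intro p hp
    rcases Finset.mem_insert.1 hp with rfl | hp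
    · refine mem_contact.2 ⟨hm.1, ?_⟩
      simp only [AffineMap.coe_add, AffineMap.coe_smul, Pi.add_apply, Pi.smul_apply, smul_eq_mul]
      rw [div_mul_cancel₀ _ hm.2.ne']
      ring
    · refine mem_contact.2 ⟨(mem_contact.1 hp).1, ?_⟩
      simp [h0 p hp, (mem_contact.1 hp).2]

theorem exists_affineMap_ne_zero_of_affineSpan_ne_top {T : Set E} (hT : affineSpan ℝ T ≠ ⊤) :
    ∃ h : E →ᵃ[ℝ] ℝ, h ≠ 0 ∧ ∀ p ∈ T, h p = 0 := by
  rcases T.eq_empty_or_nonempty with rfl | ⟨v, hv⟩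
  · exact ⟨AffineMap.const ℝ E 1, fun h => by simpa using DFunLike.congr_fun h (0 : E), by simp⟩
  · have hdir : vectorSpan ℝ T < ⊤ := by
      refine lt_top_iff_ne_top.2 fun h => hT ?_
      exact (AffineSubspace.affineSpan_eq_top_iff_vectorSpan_eq_top_of_nonempty ℝ E E ⟨v, hv⟩).2 h
    obtain ⟨f, hf, hle⟩ := Submodule.exists_le_ker_of_lt_top _ hdir
    refine ⟨f.toAffineMap - AffineMap.const ℝ E (f v), fun h => hf ?_, fun p hp => ?_⟩
    · have := congrArg AffineMap.linear h
      simpa using this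
    · have := hle (vsub_mem_vectorSpan ℝ hp hv)
      simpa using this

/-- Every affine minorant can be raised to one whose contact set spans the space, without
decreasing its value at a given point of the convex hull. -/
theorem exists_minorant_affineSpan_contact_eq_top {P : Finset E}
    (hP : affineSpan ℝ (P : Set E) = ⊤) {ω : E → ℝ} {x : E} (hx : x ∈ convexHull ℝ (P : Set E))
    {ℓ : E →ᵃ[ℝ] ℝ} (hℓ : IsMinorant P ω ℓ) :
    ∃ ℓ', IsMinorant P ω ℓ' ∧ ℓ x ≤ ℓ' x ∧ affineSpan ℝ (contact P ω ℓ' : Set E) = ⊤ := by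
  induction hk : P.card - (contact P ω ℓ).card using Nat.strong_induction_on generalizing ℓ with
  | _ k ih =>
  by_cases hT : affineSpan ℝ (contact P ω ℓ : Set E) = ⊤
  · exact ⟨ℓ, hℓ, le_rfl, hT⟩
  obtain ⟨h, hh, h0⟩ : ∃ h : E →ᵃ[ℝ] ℝ, (0 ≤ h x ∧ ∃ p ∈ P, 0 < h p) ∧
      ∀ p ∈ contact P ω ℓ, h p = 0 := by
    obtain ⟨h, hne, h0⟩ := exists_affineMap_ne_zero_of_affineSpan_ne_top hT
    wlog hx0 : 0 ≤ h x generalizing h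
    · exact this (-h) (neg_ne_zero.2 hne) (fun p hp => by simp [h0 p hp])
        (by simpa using (not_le.1 hx0).le)
    by_cases hpos : ∃ p ∈ P, 0 < h p
    · exact ⟨h, ⟨hx0, hpos⟩, h0⟩
    push Not at hpos
    -- If `h` is nowhere positive on `P`, then `h x = 0`, so the sign of `h` can be flipped at no
    -- cost at `x`; `-h` is positive somewhere because `P` spans.
    have hxle : h x ≤ (0 : E →ᵃ[ℝ] ℝ) x :=
      affineMap_le_of_mem_convexHull (fun p hp => by simpa using hpos p hp) hx
    refine ⟨-h, ⟨by simpa using hxle, ?_⟩, fun p hp => by simp [h0 p hp]⟩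
    by_contra! hneg
    refine hne (AffineMap.ext_on hP fun p hp => ?_)
    have := hneg p hp
    simp only [AffineMap.coe_neg, Pi.neg_apply, Left.neg_nonpos_iff] at this
    simpa using le_antisymm (hpos p hp) this
  obtain ⟨τ, hτ, hmin, hss⟩ := exists_contact_ssubset hℓ h h0 hh.2
  have hlt := Finset.card_lt_card hss
  have hle := Finset.card_le_card (contact_subset P ω (ℓ + τ • h))
  obtain ⟨ℓ', h1, h2, h3⟩ := ih _ (by omega) hmin rfl
  refine ⟨ℓ', h1, le_trans ?_ h2, h3⟩
  simpa using mul_nonneg hτ hh.1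

/-- Over every point of the convex hull there is an affine minorant whose contact set spans the
space and has that point in its convex hull. -/
theorem exists_minorant_mem_convexHull_contact {P : Finset E}
    (hP : affineSpan ℝ (P : Set E) = ⊤) (ω : E → ℝ) {x : E} (hx : x ∈ convexHull ℝ (P : Set E)) :
    ∃ ℓ, IsMinorant P ω ℓ ∧ affineSpan ℝ (contact P ω ℓ : Set E) = ⊤ ∧
      x ∈ convexHull ℝ (contact P ω ℓ : Set E) := by
  classical
  have hPne : P.Nonempty := by
    rw [← Finset.coe_nonempty, ← convexHull_nonempty_iff (𝕜 := ℝ)]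
    exact ⟨x, hx⟩
  let A : Set (E →ᵃ[ℝ] ℝ) :=
    {ℓ | IsMinorant P ω ℓ ∧ affineSpan ℝ (contact P ω ℓ : Set E) = ⊤}
  -- A spanning contact set determines its affine function, and `P` has finitely many subsets.
  have hfin : A.Finite := by
    refine Set.Finite.of_finite_image (f := contact P ω)
      (P.powerset.finite_toSet.subset ?_) fun ℓ hℓ ℓ' _ heq => ?_
    · rintro _ ⟨ℓ, -, rfl⟩
      simpa using contact_subset P ω ℓ
    · refine AffineMap.ext_on hℓ.2 fun p hp => ?_
      have hp' : p ∈ contact P ω ℓ' := heq ▸ hp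
      rw [(mem_contact.1 hp).2, (mem_contact.1 hp').2]
  have hne : A.Nonempty := by
    obtain ⟨m, -, hm⟩ := Finset.exists_min_image P ω hPne
    obtain ⟨ℓ, h1, -, h2⟩ := exists_minorant_affineSpan_contact_eq_top hP hx
      (ω := ω) (ℓ := AffineMap.const ℝ E (ω m)) (fun p hp => by simpa using hm p hp)
    exact ⟨ℓ, h1, h2⟩
  obtain ⟨ℓ, hℓ, hmax⟩ := Set.exists_max_image A (fun ℓ => ℓ x) hfin hne
  refine ⟨ℓ, hℓ.1, hℓ.2, ?_⟩
  by_contra hxT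
  -- A separating `h` is negative on the contact set and positive at `x`. A small multiple of it
  -- keeps `ℓ` a minorant and raises its value at `x`, against maximality.
  obtain ⟨f, u, hfu, hux⟩ := geometric_hahn_banach_closed_point (convex_convexHull ℝ _)
    ((contact P ω ℓ).finite_toSet.isCompact_convexHull (𝕜 := ℝ)).isClosed hxT
  let h : E →ᵃ[ℝ] ℝ := (f : E →ₗ[ℝ] ℝ).toAffineMap - AffineMap.const ℝ E u
  have hev : ∀ᶠ τ in 𝓝[>] (0 : ℝ), ∀ p ∈ P, ℓ p + τ * h p ≤ ω p := by
    rw [Filter.eventually_all_finset]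
    intro p hp
    by_cases hpT : p ∈ contact P ω ℓ
    · filter_upwards [self_mem_nhdsWithin] with τ hτ
      have h1 : h p < 0 := by simpa [h] using hfu p (subset_convexHull ℝ _ hpT)
      rw [(mem_contact.1 hpT).2]
      linarith [mul_neg_of_pos_of_neg hτ h1]
    · have hlt : ℓ p < ω p :=
        lt_of_le_of_ne (hℓ.1 p hp) fun h => hpT (mem_contact.2 ⟨hp, h⟩)
      have hc : Tendsto (fun τ : ℝ => ℓ p + τ * h p) (𝓝 0) (𝓝 (ℓ p + 0 * h p)) :=
        (Continuous.tendsto (by fun_prop) 0)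
      rw [zero_mul, add_zero] at hc
      filter_upwards [(hc.mono_left nhdsWithin_le_nhds).eventually (gt_mem_nhds hlt)] with τ hτ
      exact hτ.le
  obtain ⟨τ, hτ, hτ0⟩ := (hev.and self_mem_nhdsWithin).exists
  obtain ⟨ℓ', h1, h2, h3⟩ := exists_minorant_affineSpan_contact_eq_top hP hx
    (ω := ω) (ℓ := ℓ + τ • h) (fun p hp => by simpa using hτ p hp)
  have h4 := hmax ℓ' ⟨h1, h3⟩
  have h5 : 0 < h x := by simpa [h] using hux
  have h6 : ℓ x + τ * h x ≤ ℓ' x := by simpa using h2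
  linarith [mul_pos hτ0 h5]

/-- Weak duality: a minorant bounds from below the height of every convex combination over a point.
With `sum_eq_of_subset_contact`, combinations supported on contact points are seen to be the lowest.
-/
theorem le_sum_of_isMinorant {P : Finset E} {ω : E → ℝ} {ℓ : E →ᵃ[ℝ] ℝ} (hℓ : IsMinorant P ω ℓ)
    {s : Finset E} (hs : s ⊆ P) {a : E → ℝ} (ha : ∀ v ∈ s, 0 ≤ a v) (ha1 : ∑ v ∈ s, a v = 1) :
    ℓ (∑ v ∈ s, a v • v) ≤ ∑ v ∈ s, a v * ω v := by
  rw [affineMap_sum_smul ℓ ha1]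
  exact Finset.sum_le_sum fun v hv => mul_le_mul_of_nonneg_left (hℓ v (hs hv)) (ha v hv)

theorem sum_eq_of_subset_contact {P : Finset E} {ω : E → ℝ} {ℓ : E →ᵃ[ℝ] ℝ}
    {s : Finset E} (hs : s ⊆ contact P ω ℓ) {a : E → ℝ} (ha1 : ∑ v ∈ s, a v = 1) :
    ∑ v ∈ s, a v * ω v = ℓ (∑ v ∈ s, a v • v) := by
  rw [affineMap_sum_smul ℓ ha1]
  exact Finset.sum_congr rfl fun v hv => by rw [(mem_contact.1 (hs hv)).2]

/-- If a convex combination of contact points of `ℓ` lies in the convex hull of the contact set of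
`ℓ'`, then every point with a nonzero coefficient is a contact point of `ℓ'`. -/
theorem mem_contact_of_sum_mem_convexHull {P : Finset E} {ω : E → ℝ} {ℓ ℓ' : E →ᵃ[ℝ] ℝ}
    (hℓ : IsMinorant P ω ℓ) (hℓ' : IsMinorant P ω ℓ') {s : Finset E} (hs : s ⊆ contact P ω ℓ)
    {a : E → ℝ} (ha : ∀ v ∈ s, 0 ≤ a v) (ha1 : ∑ v ∈ s, a v = 1)
    (hx : ∑ v ∈ s, a v • v ∈ convexHull ℝ (contact P ω ℓ' : Set E)) {v : E} (hv : v ∈ s)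
    (hav : a v ≠ 0) : v ∈ contact P ω ℓ' := by
  have hle : ℓ (∑ v ∈ s, a v • v) ≤ ℓ' (∑ v ∈ s, a v • v) :=
    affineMap_le_of_mem_convexHull
      (fun p hp => (mem_contact.1 hp).2 ▸ hℓ p (mem_contact.1 hp).1) hx
  rw [← sum_eq_of_subset_contact hs ha1, affineMap_sum_smul ℓ' ha1] at hle
  have hsP : ∀ v ∈ s, v ∈ P := fun v hv => contact_subset _ _ _ (hs hv)
  have hle' : ∀ v ∈ s, a v * ℓ' v ≤ a v * ω v := fun v hv =>
    mul_le_mul_of_nonneg_left (hℓ' v (hsP v hv)) (ha v hv)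
  -- The two sums agree while their terms are ordered, so they agree term by term.
  have heq := (Finset.sum_eq_sum_iff_of_le hle').1 (le_antisymm (Finset.sum_le_sum hle') hle) v hv
  exact mem_contact.2 ⟨hsP v hv, mul_left_cancel₀ hav heq⟩

/-! ### Regular triangulations -/

/-- All contact sets of affine functions with `ω` are affinely independent. -/
def IsGeneric (P : Finset E) (ω : E → ℝ) : Prop :=
  ∀ ℓ : E →ᵃ[ℝ] ℝ, AffineIndependent ℝ ((↑) : contact P ω ℓ → E)

/-- The regular complex of a generic height function: the projection of its lower faces. -/
def regularComplex (P : Finset E) (ω : E → ℝ) (hω : IsGeneric P ω) : SimplicialComplex ℝ E where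
  faces := {s | s.Nonempty ∧ ∃ ℓ, IsMinorant P ω ℓ ∧ s ⊆ contact P ω ℓ}
  isRelLowerSet_faces := by
    rintro s ⟨hs, ℓ, hℓ, hsℓ⟩
    exact ⟨hs, fun t hts ht => ⟨ht, ℓ, hℓ, hts.trans hsℓ⟩⟩
  indep := by
    rintro s ⟨-, ℓ, -, hsℓ⟩
    exact (hω ℓ).mono hsℓ
  inter_subset_convexHull := by
    classical
    rintro s t ⟨-, ℓ, hℓ, hs⟩ ⟨-, ℓ', hℓ', ht⟩ x ⟨hxs, hxt⟩
    obtain ⟨a, ha, ha1, rfl⟩ := Finset.mem_convexHull'.1 hxs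
    -- The support of the weights consists of contact points of both minorants, so the intersection
    -- can be computed inside the affinely independent contact set of `ℓ'`.
    have hsub : s.filter (fun v => a v ≠ 0) ⊆ contact P ω ℓ' := fun v hv =>
      mem_contact_of_sum_mem_convexHull hℓ hℓ' hs ha ha1 (convexHull_mono (by exact_mod_cast ht) hxt)
        (Finset.mem_filter.1 hv).1 (Finset.mem_filter.1 hv).2
    have hx : ∑ v ∈ s, a v • v ∈ convexHull ℝ (s.filter (fun v => a v ≠ 0) : Set E) := by
      refine Finset.mem_convexHull'.2 ⟨a, fun v hv => ha v (Finset.mem_filter.1 hv).1, ?_, ?_⟩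
      · rw [← ha1, Finset.sum_filter_ne_zero]
      · refine Finset.sum_subset (Finset.filter_subset _ _) fun v hv hv' => ?_
        have : a v = 0 := by simpa [hv] using hv'
        simp [this]
    have := ((hω ℓ').convexHull_inter hsub ht).symm.subset ⟨hx, hxt⟩
    refine convexHull_mono (Set.inter_subset_inter_left _ ?_) this
    exact_mod_cast Finset.filter_subset _ _

end Minorants

/-! ### Generic height functions -/

section Genericity

variable {E : Type*} [NormedAddCommGroup E] [NormedSpace ℝ E]

/-- An affine dependence in `T` yields a nonzero linear functional of the heights that vanishes
whenever `ω` is affine on `T`. The complement of its kernel is open and dense. -/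
theorem exists_isOpen_dense_affineIndependent (P T : Finset E) :
    ∃ O : Set (E → ℝ), IsOpen O ∧ Dense O ∧ ∀ ω ∈ O, ∀ ℓ : E →ᵃ[ℝ] ℝ, contact P ω ℓ = T →
      AffineIndependent ℝ ((↑) : T → E) := by
  classical
  by_cases hT : AffineIndependent ℝ ((↑) : T → E)
  · exact ⟨Set.univ, isOpen_univ, dense_univ, fun _ _ _ _ => hT⟩
  rw [affineIndependent_iff] at hT
  push Not at hT
  obtain ⟨t, w, hw0, hw, e, he, hwe⟩ := hT
  let φ : (E → ℝ) →ₗ[ℝ] ℝ := ∑ v ∈ t, w v • LinearMap.proj (v : E)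
  have hφ : ∀ ω, φ ω = ∑ v ∈ t, w v * ω v := fun ω => by simp [φ]
  have hφc : Continuous φ := by
    simp only [funext hφ]
    fun_prop
  have hφe : φ (Pi.single (e : E) 1) ≠ 0 := by
    rw [hφ, Finset.sum_eq_single e]
    · simpa using hwe
    · intro v _ hve
      rw [Pi.single_eq_of_ne (fun h => hve (Subtype.ext h)), mul_zero]
    · exact fun h => absurd he h
  refine ⟨{ω | φ ω ≠ 0}, isOpen_ne_fun hφc continuous_const, ?_, fun ω hω ℓ hℓ => ?_⟩
  · have hker : interior (LinearMap.ker φ : Set (E → ℝ)) = ∅ := by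
      by_contra hne
      have htop := Submodule.eq_top_of_nonempty_interior' _ (Set.nonempty_iff_ne_empty.2 hne)
      exact hφe (LinearMap.mem_ker.1 (htop ▸ Submodule.mem_top))
    exact interior_eq_empty_iff_dense_compl.1 hker
  · refine absurd ?_ hω
    have h1 : ∀ v ∈ t, w v * ω v = w v * ℓ.linear v + w v * ℓ 0 := fun v _ => by
      have hv : (v : E) ∈ contact P ω ℓ := hℓ ▸ v.2
      rw [← (mem_contact.1 hv).2, AffineMap.decomp ℓ]
      simp [mul_add]
    rw [hφ, Finset.sum_congr rfl h1, Finset.sum_add_distrib, ← Finset.sum_mul, hw0, zero_mul,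
      add_zero]
    simpa using congrArg ℓ.linear hw

/-- Generic height functions are dense. -/
theorem dense_isGeneric (P : Finset E) : Dense {ω : E → ℝ | IsGeneric P ω} := by
  classical
  choose O hO hd hgen using exists_isOpen_dense_affineIndependent P
  have hfin : ∀ F : Finset (Finset E), IsOpen (⋂ T ∈ F, O T) ∧ Dense (⋂ T ∈ F, O T) := by
    intro F
    induction F using Finset.induction_on with
    | empty => simp
    | insert T F _ ih =>
      rw [Finset.set_biInter_insert]
      exact ⟨(hO T).inter ih.1, (hd T).inter_of_isOpen_left ih.2 (hO T)⟩
  refine (hfin P.powerset).2.mono fun ω hω ℓ => ?_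
  have hmem : contact P ω ℓ ∈ P.powerset := Finset.mem_powerset.2 (contact_subset P ω ℓ)
  exact hgen _ ω (Set.mem_iInter₂.1 hω _ hmem) ℓ rfl

end Genericity

variable {n : ℕ}

/-! ### Triangulations from generic heights -/

theorem affineSpan_eq_top_iff_card {s : Finset (Pt n)}
    (hs : AffineIndependent ℝ ((↑) : s → Pt n)) :
    affineSpan ℝ (s : Set (Pt n)) = ⊤ ↔ s.card = n + 1 := by
  have := hs.affineSpan_eq_top_iff_card_eq_finrank_add_one
  simpa using this

theorem exists_topSimplex_regularComplex {P : Finset (Pt n)}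
    (hP : affineSpan ℝ (P : Set (Pt n)) = ⊤) {ω : Pt n → ℝ} (hω : IsGeneric P ω) {x : Pt n}
    (hx : x ∈ convexHull ℝ (P : Set (Pt n))) :
    ∃ ℓ, IsMinorant P ω ℓ ∧ contact P ω ℓ ∈ topSimplices (regularComplex P ω hω) ∧
      x ∈ convexHull ℝ (contact P ω ℓ : Set (Pt n)) := by
  obtain ⟨ℓ, h1, h2, h3⟩ := exists_minorant_mem_convexHull_contact hP ω hx
  have hcard := (affineSpan_eq_top_iff_card (hω ℓ)).1 h2
  exact ⟨ℓ, h1, ⟨⟨Finset.card_pos.1 (by omega), ℓ, h1, Finset.Subset.rfl⟩, hcard⟩, h3⟩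

/-- If every point of `P` is a lower vertex, the regular complex is a triangulation of `P`. -/
theorem isTriangulation_regularComplex {P : Finset (Pt n)}
    (hP : affineSpan ℝ (P : Set (Pt n)) = ⊤) {ω : Pt n → ℝ} (hω : IsGeneric P ω)
    (hv : ∀ p ∈ P, ∃ ℓ, IsMinorant P ω ℓ ∧ p ∈ contact P ω ℓ) :
    IsTriangulation P (regularComplex P ω hω) where
  exists_top := by
    have hne : (P : Set (Pt n)).Nonempty := by
      rw [Set.nonempty_iff_ne_empty]
      intro h
      rw [h, AffineSubspace.span_empty] at hP
      exact AffineSubspace.bot_ne_top ℝ (Pt n) (Pt n) hP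
    obtain ⟨p, hp⟩ := hne
    obtain ⟨ℓ, -, h, -⟩ := exists_topSimplex_regularComplex hP hω (subset_convexHull ℝ _ hp)
    exact ⟨_, h⟩
  pure := by
    rintro s ⟨hne, ℓ, hℓ, hs⟩
    have hc : (0 : ℝ) < s.card := by exact_mod_cast hne.card_pos
    -- The barycentre has only nonzero weights, so a top simplex containing it must contain every
    -- vertex of `s`.
    have h1 : ∑ v ∈ s, (fun _ : Pt n => (s.card : ℝ)⁻¹) v = 1 := by
      simp [hc.ne']
    have hx : ∑ v ∈ s, (fun _ : Pt n => (s.card : ℝ)⁻¹) v • v ∈ convexHull ℝ (P : Set (Pt n)) :=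
      convexHull_mono (by exact_mod_cast hs.trans (contact_subset P ω ℓ))
        (Finset.mem_convexHull'.2 ⟨_, fun _ _ => (inv_pos.2 hc).le, h1, rfl⟩)
    obtain ⟨ℓ', hℓ', htop, hmem⟩ := exists_topSimplex_regularComplex hP hω hx
    exact ⟨_, htop, fun v hv => mem_contact_of_sum_mem_convexHull hℓ hℓ' hs
      (fun _ _ => (inv_pos.2 hc).le) h1 hmem hv (inv_pos.2 hc).ne'⟩
  vertices_eq := by
    ext p
    simp only [Set.mem_iUnion, Finset.mem_coe, exists_prop]
    constructor
    · rintro ⟨s, ⟨-, ℓ, -, hs⟩, hp⟩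
      exact contact_subset P ω ℓ (hs hp)
    · intro hp
      obtain ⟨ℓ, hℓ, hpℓ⟩ := hv p hp
      exact ⟨_, ⟨⟨p, hpℓ⟩, ℓ, hℓ, Finset.Subset.rfl⟩, hpℓ⟩
  space_eq := by
    ext x
    rw [SimplicialComplex.mem_space_iff]
    constructor
    · rintro ⟨s, ⟨-, ℓ, -, hs⟩, hx⟩
      exact convexHull_mono (by exact_mod_cast hs.trans (contact_subset P ω ℓ)) hx
    · intro hx
      obtain ⟨ℓ, -, htop, hmem⟩ := exists_topSimplex_regularComplex hP hω hx
      exact ⟨_, htop.1, hmem⟩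

/-! ### The Delaunay condition through the paraboloid -/

/-- The height function of the paraboloid. -/
def sqNorm (x : Pt n) : ℝ := ‖x‖ ^ 2

/-- The affine function that agrees with the paraboloid on the sphere with centre `c` and radius
`r`. -/
def sphereAffine (c : Pt n) (r : ℝ) : Pt n →ᵃ[ℝ] ℝ :=
  ((2 : ℝ) • innerₛₗ ℝ c).toAffineMap + AffineMap.const ℝ (Pt n) (r ^ 2 - ‖c‖ ^ 2)

theorem sqNorm_sub_sphereAffine (c : Pt n) (r : ℝ) (x : Pt n) :
    sqNorm x - sphereAffine c r x = dist x c ^ 2 - r ^ 2 := by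
  have := norm_sub_sq_real x c
  rw [dist_eq_norm, this, real_inner_comm]
  simp [sphereAffine, sqNorm]
  ring

/-- Completing the square. The constant `k` may be negative; it is a squared radius only once `ℓ`
touches the paraboloid. -/
theorem exists_eq_sphereAffine (ℓ : Pt n →ᵃ[ℝ] ℝ) :
    ∃ (c : Pt n) (k : ℝ), ∀ x, sqNorm x - ℓ x = dist x c ^ 2 - k := by
  let a := (InnerProductSpace.toDual ℝ (Pt n)).symm (LinearMap.toContinuousLinearMap ℓ.linear)
  have ha : ∀ x, inner ℝ a x = ℓ.linear x := fun x => by simp [a]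
  refine ⟨(2 : ℝ)⁻¹ • a, ℓ 0 + ‖(2 : ℝ)⁻¹ • a‖ ^ 2, fun x => ?_⟩
  have h1 : ℓ x = ℓ.linear x + ℓ 0 := by
    conv_lhs => rw [AffineMap.decomp ℓ]
    simp
  rw [dist_eq_norm, norm_sub_sq_real, real_inner_smul_right, real_inner_comm, ha, h1, sqNorm]
  ring

theorem Circumscribes.dist_eq {s : Finset (Pt n)} {c : Pt n} {r : ℝ} (h : Circumscribes s c r)
    {v : Pt n} (hv : v ∈ s) : dist v c = r :=
  le_antisymm (h.1 (subset_convexHull ℝ _ hv))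
    (not_lt.1 fun hlt => Set.disjoint_left.1 h.2 (Metric.mem_ball.2 hlt) hv)

/-- The circumscribing sphere of an `n`-simplex is unique. -/
theorem isCircumball_of_forall_dist_eq {s : Finset (Pt n)}
    (hs : AffineIndependent ℝ ((↑) : s → Pt n)) (hcard : s.card = n + 1) {c : Pt n} {r : ℝ}
    (h : ∀ v ∈ s, dist v c = r) : IsCircumball s c r := by
  have hspan := (affineSpan_eq_top_iff_card hs).2 hcard
  refine ⟨⟨?_, ?_⟩, fun c' r' h' => ?_⟩
  · exact convexHull_min (fun v hv => (h v hv).le) (convex_closedBall c r)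
  · exact Set.disjoint_left.2 fun v hv hvs => (Metric.mem_ball.1 hv).ne (h v hvs)
  · have hne : Nonempty s := (Finset.card_pos.1 (by omega)).to_subtype
    obtain ⟨S, -, hS⟩ := hs.existsUnique_dist_eq
    have key : ∀ c' r', (∀ v ∈ s, dist v c' = r') →
        (⟨c', r'⟩ : EuclideanGeometry.Sphere (Pt n)) = S := by
      intro c' r' hd
      refine hS _ ⟨?_, ?_⟩
      · rw [Subtype.range_coe_subtype]
        simp only [Finset.setOfPred_mem]
        rw [hspan]
        exact AffineSubspace.mem_top _ _ _
      · rintro _ ⟨v, rfl⟩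
        exact hd v v.2
    have := (key c r h).trans (key c' r' fun v hv => h'.dist_eq hv).symm
    exact (congrArg EuclideanGeometry.Sphere.radius this).le

/-- The difference between the paraboloid and an affine function is the power of a point with
respect to a sphere, so lying below the paraboloid on `P` means that the open ball is empty of `P`.
-/
theorem isDelaunaySimplex_of_isMinorant {P s : Finset (Pt n)}
    (hs : AffineIndependent ℝ ((↑) : s → Pt n)) (hcard : s.card = n + 1) {ℓ : Pt n →ᵃ[ℝ] ℝ}
    (hℓ : IsMinorant P sqNorm ℓ) (hsℓ : s ⊆ contact P sqNorm ℓ) : IsDelaunaySimplex P s := by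
  obtain ⟨c, k, hk⟩ := exists_eq_sphereAffine ℓ
  obtain ⟨v₀, hv₀⟩ : s.Nonempty := Finset.card_pos.1 (by omega)
  have hd : ∀ v ∈ s, dist v c ^ 2 = k := fun v hv => by
    have := hk v
    rw [(mem_contact.1 (hsℓ hv)).2] at this
    linarith
  refine ⟨c, dist v₀ c, isCircumball_of_forall_dist_eq hs hcard fun v hv => ?_, ?_⟩
  · exact (sq_eq_sq₀ dist_nonneg dist_nonneg).1 ((hd v hv).trans (hd v₀ hv₀).symm)
  · refine Set.disjoint_left.2 fun p hp hpP => ?_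
    have h1 := hk p
    have h2 := hℓ p hpP
    have h3 := (sq_lt_sq₀ dist_nonneg dist_nonneg).2 (Metric.mem_ball.1 hp)
    rw [hd v₀ hv₀] at h3
    linarith

theorem IsDelaunaySimplex.exists_sphere {P s : Finset (Pt n)} (h : IsDelaunaySimplex P s)
    (hs : s.Nonempty) :
    ∃ c r, 0 ≤ r ∧ (∀ v ∈ s, dist v c = r) ∧ ∀ p ∈ P, r ≤ dist p c := by
  obtain ⟨c, r, hc, hd⟩ := h
  obtain ⟨v, hv⟩ := hs
  refine ⟨c, r, hc.1.dist_eq hv ▸ dist_nonneg, fun v hv => hc.1.dist_eq hv, fun p hp => ?_⟩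
  exact not_lt.1 fun hlt => Set.disjoint_left.1 hd (Metric.mem_ball.2 hlt) hp

theorem IsDelaunaySimplex.exists_minorant {P s : Finset (Pt n)} (h : IsDelaunaySimplex P s)
    (hs : s.Nonempty) (hsP : s ⊆ P) :
    ∃ ℓ, IsMinorant P sqNorm ℓ ∧ s ⊆ contact P sqNorm ℓ := by
  obtain ⟨c, r, hr, hd, hP⟩ := h.exists_sphere hs
  refine ⟨sphereAffine c r, fun p hp => ?_, fun v hv => mem_contact.2 ⟨hsP hv, ?_⟩⟩
  · have h1 := sqNorm_sub_sphereAffine c r p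
    have h2 := pow_le_pow_left₀ hr (hP p hp) 2
    linarith
  · have h1 := sqNorm_sub_sphereAffine c r v
    rw [hd v hv, sub_self] at h1
    linarith

/-- For heights near the paraboloid, every point of `P` is a lower vertex. -/
theorem eventually_exists_minorant_contact (P : Finset (Pt n)) :
    ∀ᶠ ω in 𝓝 (sqNorm : Pt n → ℝ), ∀ p ∈ P, ∃ ℓ, IsMinorant P ω ℓ ∧ p ∈ contact P ω ℓ := by
  rw [Filter.eventually_all_finset]
  intro p hp
  -- The sphere of radius zero gives the tangent plane at `p`. It is strictly below the paraboloid
  -- at the other points, and stays below nearby heights after a vertical shift to match `ω p`.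
  have hev : ∀ᶠ ω in 𝓝 (sqNorm : Pt n → ℝ), ∀ y ∈ P,
      sphereAffine p 0 y + (ω p - sphereAffine p 0 p) ≤ ω y := by
    rw [Filter.eventually_all_finset]
    intro y hy
    by_cases hyp : y = p
    · subst hyp
      exact Eventually.of_forall fun ω => by linarith
    · have hc : Continuous fun ω : Pt n → ℝ =>
        sphereAffine p 0 y + (ω p - sphereAffine p 0 p) := by fun_prop
      have hlt : sphereAffine p 0 y + (sqNorm p - sphereAffine p 0 p) < sqNorm y := by
        have h1 := sqNorm_sub_sphereAffine p 0 y
        have h2 := sqNorm_sub_sphereAffine p 0 p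
        have h3 : 0 < dist y p ^ 2 := pow_pos (dist_pos.2 hyp) 2
        rw [dist_self] at h2
        linarith
      exact (hc.continuousAt.eventually_lt (continuous_apply y).continuousAt hlt).mono
        fun _ h => h.le
  filter_upwards [hev] with ω hω
  refine ⟨sphereAffine p 0 + AffineMap.const ℝ (Pt n) (ω p - sphereAffine p 0 p), fun y hy => ?_,
    mem_contact.2 ⟨hp, ?_⟩⟩
  · simpa using hω y hy
  · simp

theorem affineMap_sum_apply {ι : Type*} (t : Finset ι) (F : ι → Pt n →ᵃ[ℝ] ℝ) (p : Pt n) :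
    (∑ i ∈ t, F i) p = ∑ i ∈ t, F i p := by
  classical
  induction t using Finset.induction_on with
  | empty => simp
  | insert i t hi ih => simp [hi, ih]

/-- For heights near the paraboloid, every lower `n`-simplex is Delaunay. -/
theorem eventually_isDelaunaySimplex (P : Finset (Pt n)) :
    ∀ᶠ ω in 𝓝 (sqNorm : Pt n → ℝ), ∀ s ∈ P.powerset, AffineIndependent ℝ ((↑) : s → Pt n) →
      s.card = n + 1 → (∃ ℓ, IsMinorant P ω ℓ ∧ s ⊆ contact P ω ℓ) → IsDelaunaySimplex P s := by
  rw [Filter.eventually_all_finset]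
  intro s hsP
  by_cases hs : AffineIndependent ℝ ((↑) : s → Pt n) ∧ s.card = n + 1
  swap
  · exact Eventually.of_forall fun ω h1 h2 => absurd ⟨h1, h2⟩ hs
  obtain ⟨hs, hcard⟩ := hs
  let b : AffineBasis s ℝ (Pt n) :=
    ⟨(↑), hs, by simpa using (affineSpan_eq_top_iff_card hs).2 hcard⟩
  have hb : ∀ v : s, b v = (v : Pt n) := fun _ => rfl
  let I : (Pt n → ℝ) → Pt n →ᵃ[ℝ] ℝ := fun ω => ∑ v : s, ω v • b.coord v
  have hI : ∀ ω p, I ω p = ∑ v : s, ω v * b.coord v p := fun ω p => by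
    rw [affineMap_sum_apply]
    simp
  have hIv : ∀ ω, ∀ v ∈ s, I ω v = ω v := fun ω v hv => by
    classical
    rw [hI, Finset.sum_eq_single ⟨v, hv⟩]
    · have := b.coord_apply_eq ⟨v, hv⟩
      rw [hb] at this
      rw [this, mul_one]
    · intro w _ hw
      have := b.coord_apply_ne hw
      rw [hb] at this
      rw [this, mul_zero]
    · simp
  -- If the interpolant of the paraboloid on `s` is a minorant, `s` is Delaunay whatever `ω` is.
  -- Otherwise it fails strictly at some point, and so does the interpolant of every nearby `ω`,
  -- which is the only candidate for `ℓ`.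
  by_cases hmin : IsMinorant P sqNorm (I sqNorm)
  · refine Eventually.of_forall fun ω _ _ _ => isDelaunaySimplex_of_isMinorant hs hcard hmin
      fun v hv => mem_contact.2 ⟨Finset.mem_powerset.1 hsP hv, hIv _ v hv⟩
  · simp only [IsMinorant, not_forall, not_le] at hmin
    obtain ⟨p, hp, hlt⟩ := hmin
    have hc : Continuous fun ω => I ω p := by
      simp only [hI]
      fun_prop
    filter_upwards [(continuous_apply p).continuousAt.eventually_lt hc.continuousAt hlt]
      with ω hω _ _ ⟨ℓ, hℓ, hsℓ⟩
    have heq : ℓ = I ω := AffineMap.ext_on ((affineSpan_eq_top_iff_card hs).2 hcard) fun v hv => by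
      rw [hIv ω v hv, (mem_contact.1 (hsℓ hv)).2]
    exact absurd (hℓ p hp) (not_le.2 (heq ▸ hω))

/-! ### Nearly optimal Delaunay triangulations -/

theorem sum_mul_add_mul_add {ι : Type*} {s : Finset ι} {a u g : ι → ℝ} {ε κ : ℝ}
    (ha : ∑ v ∈ s, a v = 1) :
    ∑ v ∈ s, a v * (u v + ε * g v + κ) = ∑ v ∈ s, a v * u v + ε * ∑ v ∈ s, a v * g v + κ := by
  have hκ : κ = ∑ v ∈ s, a v * κ := by rw [← Finset.sum_mul, ha, one_mul]
  conv_rhs => rw [hκ]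
  rw [Finset.mul_sum, ← Finset.sum_add_distrib, ← Finset.sum_add_distrib]
  exact Finset.sum_congr rfl fun v _ => by ring

/-- There is a Delaunay triangulation of `P` that interpolates `g` at each point by a value at most
`δ` above the value of any other convex combination representing that point, as long as the other
combination is not higher on the paraboloid. -/
theorem exists_delaunay_interpolation_le {P : Finset (Pt n)}
    (hP : affineSpan ℝ (P : Set (Pt n)) = ⊤) (g : Pt n → ℝ) {δ : ℝ} (hδ : 0 < δ) :
    ∃ Δ : SimplicialComplex ℝ (Pt n), IsDelaunayTriangulation P Δ ∧
      ∀ s ∈ topSimplices Δ, ∀ a : Pt n → ℝ, (∀ v ∈ s, 0 ≤ a v) → ∑ v ∈ s, a v = 1 →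
      ∀ m : Pt n → ℝ, (∀ v ∈ P, 0 ≤ m v) → ∑ v ∈ P, m v = 1 →
      ∑ v ∈ P, m v • v = ∑ v ∈ s, a v • v →
      ∑ v ∈ P, m v * sqNorm v ≤ ∑ v ∈ s, a v * sqNorm v →
      ∑ v ∈ s, a v * g v ≤ ∑ v ∈ P, m v * g v + δ := by
  obtain ⟨O, hO, hOo, hOm⟩ := eventually_nhds_iff.1
    ((eventually_exists_minorant_contact P).and (eventually_isDelaunaySimplex P))
  obtain ⟨ε, hεO, hε⟩ : ∃ ε : ℝ, (sqNorm + ε • g : Pt n → ℝ) ∈ O ∧ 0 < ε := by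
    have hc : Tendsto (fun ε : ℝ => (sqNorm + ε • g : Pt n → ℝ)) (𝓝 0) (𝓝 (sqNorm + (0 : ℝ) • g)) :=
      Continuous.tendsto (by fun_prop) 0
    rw [zero_smul, add_zero] at hc
    exact (((hc.mono_left nhdsWithin_le_nhds).eventually (hOo.mem_nhds hOm)).and
      (self_mem_nhdsWithin (s := Set.Ioi (0 : ℝ)))).exists
  -- With `ε` fixed, the generic error enters once for each of the two combinations: together at
  -- most `ε * δ`, hence `δ` after division by `ε`.
  have hnear : ∀ᶠ ω in 𝓝 (sqNorm + ε • g : Pt n → ℝ), ∀ p ∈ P,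
      |ω p - (sqNorm p + ε * g p)| < ε * (δ / 2) := by
    rw [Filter.eventually_all_finset]
    intro p _
    have hc : Continuous fun ω : Pt n → ℝ => |ω p - (sqNorm p + ε * g p)| := by fun_prop
    refine hc.continuousAt.eventually_lt continuousAt_const ?_
    simpa using mul_pos hε (half_pos hδ)
  obtain ⟨ω, hgen, hωO, hωn⟩ := (dense_isGeneric P).inter_nhds_nonempty
    ((hOo.eventually_mem hεO).and hnear)
  obtain ⟨hvert, hdel⟩ := hO ω hωO
  refine ⟨regularComplex P ω hgen, ⟨isTriangulation_regularComplex hP hgen hvert, ?_⟩, ?_⟩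
  · rintro s ⟨hs, hcard⟩
    obtain ⟨-, ℓ, hℓ, hsℓ⟩ := id hs
    exact hdel s (Finset.mem_powerset.2 (hsℓ.trans (contact_subset P ω ℓ)))
      ((regularComplex P ω hgen).indep hs) hcard ⟨ℓ, hℓ, hsℓ⟩
  · rintro s ⟨⟨-, ℓ, hℓ, hsℓ⟩, -⟩ a ha ha1 m hm hm1 hx hsq
    have hsP : s ⊆ P := hsℓ.trans (contact_subset P ω ℓ)
    have h1 : ∑ v ∈ s, a v * ω v ≤ ∑ v ∈ P, m v * ω v := by
      rw [sum_eq_of_subset_contact hsℓ ha1, ← hx]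
      exact le_sum_of_isMinorant hℓ Finset.Subset.rfl hm hm1
    have h2 : ∑ v ∈ s, a v * (sqNorm v + ε * g v + -(ε * (δ / 2))) ≤ ∑ v ∈ s, a v * ω v :=
      Finset.sum_le_sum fun v hv => mul_le_mul_of_nonneg_left
        (by linarith [(abs_lt.1 (hωn v (hsP hv))).1]) (ha v hv)
    have h3 : ∑ v ∈ P, m v * ω v ≤ ∑ v ∈ P, m v * (sqNorm v + ε * g v + ε * (δ / 2)) :=
      Finset.sum_le_sum fun v hv => mul_le_mul_of_nonneg_left
        (by linarith [(abs_lt.1 (hωn v hv)).2]) (hm v hv)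
    rw [sum_mul_add_mul_add ha1] at h2
    rw [sum_mul_add_mul_add hm1] at h3
    refine le_of_mul_le_mul_left ?_ hε
    linarith

/-! ### Boxes and grids -/

theorem mem_convexHull_corners {a b : Fin n → ℝ} {w : Pt n} (ha : ∀ i, a i ≤ w i)
    (hb : ∀ i, w i ≤ b i) :
    w ∈ convexHull ℝ {x : Pt n | ∀ i, x i = a i ∨ x i = b i} := by
  let e := (WithLp.linearEquiv 2 ℝ (Fin n → ℝ)).symm
  have himg : {x : Pt n | ∀ i, x i = a i ∨ x i = b i} =
      e.toLinearMap '' Set.univ.pi fun i => {a i, b i} := by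
    ext x
    constructor
    · intro hx
      exact ⟨x.ofLp, fun i _ => hx i, rfl⟩
    · rintro ⟨y, hy, rfl⟩ i
      exact hy i trivial
  rw [himg, ← LinearMap.image_convexHull, convexHull_pi]
  refine ⟨w.ofLp, fun i _ => ?_, rfl⟩
  dsimp only
  rw [convexHull_pair, segment_eq_Icc ((ha i).trans (hb i))]
  exact ⟨ha i, hb i⟩

/-- The affine function that agrees with the paraboloid at the corners of the box with opposite
corners `a` and `b`. -/
def boxAffine (a b : Fin n → ℝ) : Pt n →ᵃ[ℝ] ℝ :=
  (∑ i, (a i + b i) • (EuclideanSpace.proj i : Pt n →L[ℝ] ℝ).toLinearMap).toAffineMap -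
    AffineMap.const ℝ (Pt n) (∑ i, a i * b i)

theorem sqNorm_sub_boxAffine (a b : Fin n → ℝ) (x : Pt n) :
    sqNorm x - boxAffine a b x = ∑ i, (x i - a i) * (x i - b i) := by
  have h : boxAffine a b x = ∑ i, (a i + b i) * x i - ∑ i, a i * b i := by
    simp [boxAffine]
  rw [h, sqNorm, EuclideanSpace.real_norm_sq_eq, ← Finset.sum_sub_distrib, ← Finset.sum_sub_distrib]
  exact Finset.sum_congr rfl fun i _ => by ring

/-- The ends are the last grid value not above `W` and the first not below it. They coincide when
`W` is a single grid value; the product is then a square. -/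
theorem exists_cell_of_no_mem_between {G : Finset ℝ} {W : Finset ℝ} (hW : W.Nonempty)
    (hlo : ∀ w ∈ W, ∃ t ∈ G, t ≤ w) (hhi : ∀ w ∈ W, ∃ t ∈ G, w ≤ t)
    (hno : ∀ w ∈ W, ∀ w' ∈ W, ∀ t ∈ G, ¬ (w < t ∧ t < w')) :
    ∃ a ∈ G, ∃ b ∈ G, (∀ w ∈ W, a ≤ w ∧ w ≤ b) ∧ ∀ t ∈ G, 0 ≤ (t - a) * (t - b) := by
  classical
  have hmin := W.min'_mem hW
  have hmax := W.max'_mem hW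
  obtain ⟨t₀, ht₀, ht₀'⟩ := hlo _ hmin
  obtain ⟨t₁, ht₁, ht₁'⟩ := hhi _ hmax
  obtain ⟨a, ha, hamax⟩ := Finset.exists_max_image (G.filter (· ≤ W.min' hW)) id
    ⟨t₀, Finset.mem_filter.2 ⟨ht₀, ht₀'⟩⟩
  obtain ⟨b, hb, hbmin⟩ := Finset.exists_min_image (G.filter (W.max' hW ≤ ·)) id
    ⟨t₁, Finset.mem_filter.2 ⟨ht₁, ht₁'⟩⟩
  simp only [Finset.mem_filter, id] at ha hb hamax hbmin
  refine ⟨a, ha.1, b, hb.1, fun w hw => ⟨ha.2.trans (W.min'_le w hw), (W.le_max' w hw).trans hb.2⟩,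
    fun t ht => ?_⟩
  have hab : a ≤ b := ha.2.trans ((W.min'_le _ hmax).trans hb.2)
  rcases le_or_gt t (W.min' hW) with h1 | h1
  · have := hamax t ⟨ht, h1⟩
    exact mul_nonneg_of_nonpos_of_nonpos (by linarith) (by linarith)
  · rcases le_or_gt (W.max' hW) t with h2 | h2
    · have := hbmin t ⟨ht, h2⟩
      exact mul_nonneg (by linarith) (by linarith)
    · exact absurd ⟨h1, h2⟩ (hno _ hmin _ hmax t ht)

theorem dist_sq_update (w c : Pt n) (i : Fin n) (t : ℝ) :
    dist (WithLp.toLp 2 (Function.update w.ofLp i t) : Pt n) c ^ 2 =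
      dist w c ^ 2 - (w i - c i) ^ 2 + (t - c i) ^ 2 := by
  simp only [dist_eq_norm, EuclideanSpace.real_norm_sq_eq, PiLp.sub_apply]
  rw [← Finset.add_sum_erase _ _ (Finset.mem_univ i), ← Finset.add_sum_erase Finset.univ
    (fun j => (w j - c j) ^ 2) (Finset.mem_univ i)]
  have h : ∀ j ∈ Finset.univ.erase i,
      (Function.update w.ofLp i t j - c j) ^ 2 = (w j - c j) ^ 2 := fun j hj => by
    rw [Function.update_of_ne (Finset.ne_of_mem_erase hj)]
  rw [Finset.sum_congr rfl h]
  simp only [Function.update_self]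
  ring

theorem mem_proj_iff_of_grid {P : Finset (Pt n)} {G : Fin n → Finset ℝ} (hne : P.Nonempty)
    (hG : ∀ x : Pt n, x ∈ P ↔ ∀ i, x i ∈ G i) (i : Fin n) (t : ℝ) : t ∈ proj P i ↔ t ∈ G i := by
  constructor
  · intro h
    obtain ⟨p, hp, rfl⟩ := Finset.mem_image.1 h
    exact (hG p).1 hp i
  · intro h
    obtain ⟨p, hp⟩ := hne
    refine Finset.mem_image.2 ⟨WithLp.toLp 2 (Function.update p.ofLp i t), (hG _).2 fun j => ?_,
      by simp⟩
    by_cases hj : j = i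
    · subst hj
      simpa using h
    · simpa [hj] using (hG p).1 hp j

theorem exists_mem_grid_le_of_mem_convexHull {P : Finset (Pt n)} {G : Fin n → Finset ℝ}
    (hne : ∀ i, (G i).Nonempty) (hG : ∀ x : Pt n, x ∈ P ↔ ∀ i, x i ∈ G i) {q : Pt n}
    (hq : q ∈ convexHull ℝ (P : Set (Pt n))) (i : Fin n) :
    (∃ t ∈ G i, t ≤ q i) ∧ ∃ t ∈ G i, q i ≤ t := by
  have hconv : Convex ℝ ((EuclideanSpace.proj i : Pt n →L[ℝ] ℝ).toLinearMap ⁻¹'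
      Set.Icc ((G i).min' (hne i)) ((G i).max' (hne i))) :=
    (convex_Icc _ _).linear_preimage _
  have hmem := convexHull_min (fun p hp => ?_) hconv hq
  · exact ⟨⟨_, (G i).min'_mem (hne i), hmem.1⟩, ⟨_, (G i).max'_mem (hne i), hmem.2⟩⟩
  · have := (hG p).1 hp i
    exact ⟨(G i).min'_le _ this, (G i).le_max' _ this⟩

/-- A point of `P + q` lies between members of the grid in every coordinate. -/
theorem exists_mem_grid_le_of_mem_gridExpand {P : Finset (Pt n)} {G : Fin n → Finset ℝ}
    (hne : ∀ i, (G i).Nonempty) (hG : ∀ x : Pt n, x ∈ P ↔ ∀ i, x i ∈ G i) {q w : Pt n}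
    (hq : q ∈ convexHull ℝ (P : Set (Pt n))) (hw : w ∈ gridExpand P q) (i : Fin n) :
    (∃ t ∈ G i, t ≤ w i) ∧ ∃ t ∈ G i, w i ≤ t := by
  rcases mem_gridExpand.1 hw i with h | h
  · rw [h]
    exact exists_mem_grid_le_of_mem_convexHull hne hG hq i
  · obtain ⟨p, hp, hpw⟩ := Finset.mem_image.1 h
    have := (hG p).1 hp i
    exact ⟨⟨_, this, hpw.le⟩, ⟨_, this, hpw.ge⟩⟩

theorem convexHull_gridExpand {P : Finset (Pt n)} (hP : IsGrid P) {q : Pt n}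
    (hq : q ∈ convexHull ℝ (P : Set (Pt n))) :
    convexHull ℝ (gridExpand P q : Set (Pt n)) = convexHull ℝ (P : Set (Pt n)) := by
  obtain ⟨G, hcard, hG⟩ := hP
  have hne : ∀ i, (G i).Nonempty := fun i => Finset.card_pos.1 (by linarith [hcard i])
  refine subset_antisymm (convexHull_min (fun w hw => ?_) (convex_convexHull ℝ _))
    (convexHull_mono (by exact_mod_cast subset_gridExpand P q))
  choose hlo hhi using exists_mem_grid_le_of_mem_gridExpand hne hG hq hw
  choose a ha haw using hlo
  choose b hb hbw using hhi
  refine convexHull_mono (fun p hp => (hG p).2 fun i => ?_) (mem_convexHull_corners haw hbw)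
  rcases hp i with h | h <;> rw [h]
  exacts [ha i, hb i]

/-- A Delaunay simplex of `P + q` lies in a cell of `P`. -/
theorem exists_minorant_of_isDelaunaySimplex_gridExpand {P : Finset (Pt n)} (hP : IsGrid P)
    {q : Pt n} (hq : q ∈ convexHull ℝ (P : Set (Pt n))) {s : Finset (Pt n)} (hs : s.Nonempty)
    (hsP : s ⊆ gridExpand P q) (hdel : IsDelaunaySimplex (gridExpand P q) s) :
    ∃ ℓ, IsMinorant P sqNorm ℓ ∧
      ∀ w ∈ s, w ∈ convexHull ℝ (contact P sqNorm ℓ : Set (Pt n)) := by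
  classical
  obtain ⟨G, hcard, hG⟩ := hP
  have hne : ∀ i, (G i).Nonempty := fun i => Finset.card_pos.1 (by linarith [hcard i])
  have hPne : P.Nonempty := by
    rw [← Finset.coe_nonempty, ← convexHull_nonempty_iff (𝕜 := ℝ)]
    exact ⟨q, hq⟩
  obtain ⟨c, r, hr, hd, hball⟩ := hdel.exists_sphere hs
  -- Replacing one coordinate of a vertex by a grid value stays in `P + q`, so the new point is not
  -- in the open ball; only that coordinate affects the comparison of distances.
  have hswap : ∀ w ∈ s, ∀ i, ∀ t ∈ G i, (w i - c i) ^ 2 ≤ (t - c i) ^ 2 := by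
    intro w hw i t ht
    have hmem : (WithLp.toLp 2 (Function.update w.ofLp i t) : Pt n) ∈ gridExpand P q := by
      refine mem_gridExpand.2 fun j => ?_
      by_cases hj : j = i
      · subst hj
        exact Or.inr ((mem_proj_iff_of_grid hPne hG j _).2 (by simpa using ht))
      · simpa [hj] using mem_gridExpand.1 (hsP hw) j
    have h1 := pow_le_pow_left₀ hr (hball _ hmem) 2
    rw [dist_sq_update, hd w hw] at h1
    linarith
  have hcell : ∀ i, ∃ a ∈ G i, ∃ b ∈ G i, (∀ w ∈ s, a ≤ w i ∧ w i ≤ b) ∧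
      ∀ t ∈ G i, 0 ≤ (t - a) * (t - b) := by
    intro i
    have hlo : ∀ y ∈ s.image fun w => w i, ∃ t ∈ G i, t ≤ y := by
      rw [Finset.forall_mem_image]
      exact fun w hw => (exists_mem_grid_le_of_mem_gridExpand hne hG hq (hsP hw) i).1
    have hhi : ∀ y ∈ s.image fun w => w i, ∃ t ∈ G i, y ≤ t := by
      rw [Finset.forall_mem_image]
      exact fun w hw => (exists_mem_grid_le_of_mem_gridExpand hne hG hq (hsP hw) i).2
    have hno : ∀ y ∈ s.image fun w => w i, ∀ y' ∈ s.image fun w => w i, ∀ t ∈ G i,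
        ¬ (y < t ∧ t < y') := by
      simp only [Finset.forall_mem_image]
      rintro w hw w' hw' t ht ⟨h1, h2⟩
      have h3 := hswap w hw i t ht
      have h4 := hswap w' hw' i t ht
      -- Here `h3` puts `c i` at or below the midpoint of `w i` and `t`, while `h4` puts it at or
      -- above the midpoint of `t` and `w' i`, which is larger.
      have h5 : 2 * c i ≤ t + w i := by nlinarith
      nlinarith
    obtain ⟨a, ha, b, hb, hab, hG'⟩ := exists_cell_of_no_mem_between (hs.image _) hlo hhi hno
    exact ⟨a, ha, b, hb, fun w hw => hab _ (Finset.mem_image_of_mem _ hw), hG'⟩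
  choose a ha b hb hab hG' using hcell
  refine ⟨boxAffine a b, fun p hp => ?_, fun w hw => ?_⟩
  · have h := sqNorm_sub_boxAffine a b p
    have h' : 0 ≤ ∑ i, (p i - a i) * (p i - b i) :=
      Finset.sum_nonneg fun i _ => hG' i _ ((hG p).1 hp i)
    linarith
  · refine convexHull_mono (fun p hp => mem_contact.2 ⟨(hG p).2 fun i => ?_, ?_⟩)
      (mem_convexHull_corners (fun i => (hab i w hw).1) fun i => (hab i w hw).2)
    · rcases hp i with h | h <;> rw [h]
      exacts [ha i, hb i]
    · have h := sqNorm_sub_boxAffine a b p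
      rw [Finset.sum_eq_zero fun i _ => ?_] at h
      · linarith
      · rcases hp i with h | h <;> simp [h]

/-! ### Interpolated values -/

theorem IsTriangulation.subset_points {P : Finset (Pt n)} {Δ : SimplicialComplex ℝ (Pt n)}
    (h : IsTriangulation P Δ) {s : Finset (Pt n)} (hs : s ∈ Δ.faces) : s ⊆ P := fun v hv => by
  have : v ∈ (P : Set (Pt n)) := h.vertices_eq ▸ Set.mem_biUnion hs hv
  exact this

theorem IsTriangulation.exists_isConvexCoords {P : Finset (Pt n)} {Δ : SimplicialComplex ℝ (Pt n)}
    (h : IsTriangulation P Δ) {x : Pt n} (hx : x ∈ convexHull ℝ (P : Set (Pt n))) :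
    ∃ c, IsConvexCoords Δ x c := by
  rw [← h.space_eq, SimplicialComplex.mem_space_iff] at hx
  obtain ⟨s, hs, hxs⟩ := hx
  obtain ⟨t, ht, hst⟩ := h.pure s hs
  obtain ⟨a, h1, h2, h3⟩ := Finset.mem_convexHull'.1
    (convexHull_mono (Finset.coe_subset.2 hst) hxs)
  exact ⟨(t, a), ht, h1, h2, h3⟩

/-- Treats both branches of the refinement alike: off the star of `q` the point is a vertex of `Δ`
and carries the trivial weights. -/
theorem exists_isConvexCoords_interpFun {P : Finset (Pt n)} (hP : IsGrid P)
    {Δ : SimplicialComplex ℝ (Pt n)} (hΔ : IsTriangulation P Δ) {q w : Pt n}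
    (hq : q ∈ convexHull ℝ (P : Set (Pt n))) (hw : w ∈ gridExpand P q) (g : Pt n → ℝ) :
    ∃ c, IsConvexCoords Δ w c ∧ interpFun P Δ g q w = ∑ v ∈ c.1, c.2 v * g v := by
  classical
  unfold interpFun
  split_ifs with hstar
  · have hex : ∃ c, IsConvexCoords Δ w c := hΔ.exists_isConvexCoords
      (convexHull_gridExpand hP hq ▸ subset_convexHull ℝ _ hw)
    refine ⟨hex.choose, hex.choose_spec, ?_⟩
    rw [interpolate, dif_pos hex]
  · obtain ⟨G, -, hG⟩ := hP
    have hwP : w ∈ (P : Set (Pt n)) := (hG w).2 fun i => by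
      rcases mem_gridExpand.1 hw i with h | h
      · exact absurd ⟨hw, i, h⟩ hstar
      · obtain ⟨p, hp, hpw⟩ := Finset.mem_image.1 h
        exact hpw ▸ (hG p).1 hp i
    rw [← hΔ.vertices_eq] at hwP
    obtain ⟨s, hs, hws⟩ := Set.mem_iUnion₂.1 hwP
    obtain ⟨t, ht, hst⟩ := hΔ.pure s hs
    have hwt : w ∈ t := hst hws
    refine ⟨(t, fun v => if v = w then 1 else 0), ⟨ht, fun v _ => ?_, ?_, ?_⟩, ?_⟩
    · dsimp only
      split_ifs <;> norm_num
    · simp [hwt]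
    · simp [hwt]
    · simp [hwt]

/-- The simplex and weights chosen by `interpolate` do not depend on `g`. This reduces lower bounds
to upper bounds. -/
theorem interpFun_neg (P : Finset (Pt n)) (Δ : SimplicialComplex ℝ (Pt n)) (g : Pt n → ℝ)
    (q x : Pt n) : interpFun P Δ (fun p => -g p) q x = -interpFun P Δ g q x := by
  unfold interpFun interpolate
  split_ifs <;> simp

/-- The interpolated value at a point of `P + q`, as a convex combination of values on `P` that is
lowest on the paraboloid. -/
theorem exists_weights_interpFun {P : Finset (Pt n)} (hP : IsGrid P)
    {Δ : SimplicialComplex ℝ (Pt n)} (hΔ : IsDelaunayTriangulation P Δ) {q w : Pt n}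
    (hq : q ∈ convexHull ℝ (P : Set (Pt n))) (hw : w ∈ gridExpand P q) (g : Pt n → ℝ) :
    ∃ m : Pt n → ℝ, (∀ v ∈ P, 0 ≤ m v) ∧ ∑ v ∈ P, m v = 1 ∧ ∑ v ∈ P, m v • v = w ∧
      ∑ v ∈ P, m v * g v = interpFun P Δ g q w ∧
      ∃ ℓ, IsMinorant P sqNorm ℓ ∧ ∑ v ∈ P, m v * sqNorm v = ℓ w := by
  classical
  obtain ⟨⟨s, a⟩, ⟨hs, ha, ha1, hax⟩, hval⟩ :=
    exists_isConvexCoords_interpFun hP hΔ.toIsTriangulation hq hw g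
  dsimp only at hs ha ha1 hax hval
  have hsP : s ⊆ P := hΔ.subset_points hs.1
  obtain ⟨ℓ, hℓ, hsℓ⟩ :=
    (hΔ.delaunay s hs).exists_minorant (Δ.nonempty_of_mem_faces hs.1) hsP
  refine ⟨fun v => if v ∈ s then a v else 0, fun v _ => ?_, ?_, ?_, ?_, ℓ, hℓ, ?_⟩
  · dsimp only
    split_ifs with h
    exacts [ha v h, le_rfl]
  · rw [Finset.sum_ite_mem, Finset.inter_eq_right.2 hsP, ha1]
  · simp only [ite_smul, zero_smul]
    rw [Finset.sum_ite_mem, Finset.inter_eq_right.2 hsP, hax]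
  · simp only [ite_mul, zero_mul]
    rw [Finset.sum_ite_mem, Finset.inter_eq_right.2 hsP, hval]
  · simp only [ite_mul, zero_mul]
    rw [Finset.sum_ite_mem, Finset.inter_eq_right.2 hsP, sum_eq_of_subset_contact hsℓ ha1, hax]

/-- A bound by the interpolation of `g` in every Delaunay triangulation of `P` is inherited by the
interpolation of the refined values in every Delaunay simplex of `P + q`. -/
theorem le_sum_mul_interpFun {P : Finset (Pt n)} (hP : IsGrid P)
    (hspan : affineSpan ℝ (P : Set (Pt n)) = ⊤) {Δ : SimplicialComplex ℝ (Pt n)}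
    (hΔ : IsDelaunayTriangulation P Δ) {q : Pt n} (hq : q ∈ convexHull ℝ (P : Set (Pt n)))
    {s : Finset (Pt n)} (hs : s.Nonempty) (hsP : s ⊆ gridExpand P q)
    (hdel : IsDelaunaySimplex (gridExpand P q) s) {θ : Pt n → ℝ} (hθ : ∀ w ∈ s, 0 ≤ θ w)
    (hθ1 : ∑ w ∈ s, θ w = 1) (g : Pt n → ℝ) {y : ℝ}
    (hy : ∀ Δ' : SimplicialComplex ℝ (Pt n), IsDelaunayTriangulation P Δ' →
      ∃ c, IsConvexCoords Δ' (∑ w ∈ s, θ w • w) c ∧ y ≤ ∑ v ∈ c.1, c.2 v * g v) :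
    y ≤ ∑ w ∈ s, θ w * interpFun P Δ g q w := by
  refine le_of_forall_pos_le_add fun δ hδ => ?_
  obtain ⟨ℓ, hℓ, hsℓ⟩ := exists_minorant_of_isDelaunaySimplex_gridExpand hP hq hs hsP hdel
  have hw := fun w : s => exists_weights_interpFun hP hΔ hq (hsP w.2) g
  choose m hm0 hm1 hmw hmg κ hκ hmκ using hw
  -- The triangulation is adapted to `g` and `δ`; this is why the bound is needed in every Delaunay
  -- triangulation of `P`.
  obtain ⟨Δ', hΔ', hle⟩ := exists_delaunay_interpolation_le hspan g hδ
  obtain ⟨⟨t, a⟩, ⟨ht, ha, ha1, hax⟩, hya⟩ := hy Δ' hΔ'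
  dsimp only at ht ha ha1 hax hya
  have hcomm : ∀ u : Pt n → ℝ, ∑ v ∈ P, (∑ w : s, θ w * m w v) * u v =
      ∑ w : s, θ w * ∑ v ∈ P, m w v * u v := fun u => by
    simp only [Finset.sum_mul, Finset.mul_sum, mul_assoc]
    exact Finset.sum_comm
  have hsum : ∑ v ∈ P, (∑ w : s, θ w * m w v) * g v = ∑ w ∈ s, θ w * interpFun P Δ g q w := by
    rw [hcomm, ← Finset.sum_coe_sort s]
    exact Finset.sum_congr rfl fun w _ => by rw [hmg]
  rw [← hsum]
  refine hya.trans (hle t ht a ha ha1 _ (fun v hv => Finset.sum_nonneg fun w _ =>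
    mul_nonneg (hθ w w.2) (hm0 w v hv)) ?_ ?_ ?_)
  · have := hcomm fun _ => 1
    simp only [mul_one] at this
    rw [this, ← hθ1, ← Finset.sum_coe_sort s]
    exact Finset.sum_congr rfl fun w _ => by rw [hm1, mul_one]
  · rw [hax]
    simp only [Finset.sum_smul]
    rw [Finset.sum_comm, ← Finset.sum_coe_sort s]
    refine Finset.sum_congr rfl fun w _ => ?_
    simp only [mul_smul]
    rw [← Finset.smul_sum, hmw]
  · rw [hcomm]
    -- On the contact set of `ℓ` each `κ w` is at most the paraboloid, hence at most `ℓ`; this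
    -- passes to the cell, which contains `w`. As one `ℓ` serves all `w`, the total is at most `ℓ`
    -- at the represented point.
    have h1 : ∑ w : s, θ w * ∑ v ∈ P, m w v * sqNorm v ≤ ∑ w : s, θ w * ℓ w :=
      Finset.sum_le_sum fun w _ => mul_le_mul_of_nonneg_left
        (by
          rw [hmκ]
          exact affineMap_le_of_mem_convexHull
            (fun p hp => (mem_contact.1 hp).2 ▸ hκ w p (mem_contact.1 hp).1) (hsℓ w w.2))
        (hθ w w.2)
    refine h1.trans ?_
    rw [Finset.sum_coe_sort s fun w => θ w * ℓ w, ← affineMap_sum_smul ℓ hθ1, ← hax]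
    exact le_sum_of_isMinorant hℓ (hΔ'.subset_points ht.1) ha ha1

/-! ### Polyhedra over a simplex -/

theorem BoundingSet.exists_weights_of_mem_polyhedron (B : BoundingSet n) {s : Finset (Pt n)}
    (hs : s ⊆ B.points) {z : Pt n × ℝ} (hz : z ∈ B.polyhedron s) :
    ∃ a : Pt n → ℝ, (∀ v ∈ s, 0 ≤ a v) ∧ ∑ v ∈ s, a v = 1 ∧ ∑ v ∈ s, a v • v = z.1 ∧
      ∑ v ∈ s, a v * B.L v ≤ z.2 ∧ z.2 ≤ ∑ v ∈ s, a v * B.U v := by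
  classical
  refine convexHull_min (t := {z : Pt n × ℝ | ∃ a : Pt n → ℝ, (∀ v ∈ s, 0 ≤ a v) ∧
    ∑ v ∈ s, a v = 1 ∧ ∑ v ∈ s, a v • v = z.1 ∧ ∑ v ∈ s, a v * B.L v ≤ z.2 ∧
      z.2 ≤ ∑ v ∈ s, a v * B.U v}) ?_ ?_ hz
  · have hpt : ∀ p ∈ s, ∀ y, B.L p ≤ y → y ≤ B.U p → ∃ a : Pt n → ℝ, (∀ v ∈ s, 0 ≤ a v) ∧
        ∑ v ∈ s, a v = 1 ∧ ∑ v ∈ s, a v • v = p ∧ ∑ v ∈ s, a v * B.L v ≤ y ∧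
          y ≤ ∑ v ∈ s, a v * B.U v := by
      intro p hp y h1 h2
      refine ⟨fun v => if v = p then 1 else 0, fun v _ => ?_, ?_, ?_, ?_, ?_⟩
      · dsimp only
        split_ifs <;> norm_num
      all_goals simp [hp, h1, h2]
    rintro _ (⟨p, hp, rfl⟩ | ⟨p, hp, rfl⟩)
    · exact hpt p hp _ le_rfl (B.L_le_U p (hs hp))
    · exact hpt p hp _ (B.L_le_U p (hs hp)) le_rfl
  · rintro z ⟨a, ha, ha1, hax, haL, haU⟩ z' ⟨b, hb, hb1, hbx, hbL, hbU⟩ t u ht hu htu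
    have hlin : ∀ g : Pt n → ℝ, ∑ v ∈ s, (t * a v + u * b v) * g v =
        t * ∑ v ∈ s, a v * g v + u * ∑ v ∈ s, b v * g v := fun g => by
      simp only [add_mul, Finset.sum_add_distrib, Finset.mul_sum, mul_assoc]
    refine ⟨fun v => t * a v + u * b v, fun v hv => ?_, ?_, ?_, ?_, ?_⟩
    · exact add_nonneg (mul_nonneg ht (ha v hv)) (mul_nonneg hu (hb v hv))
    · rw [Finset.sum_add_distrib, ← Finset.mul_sum, ← Finset.mul_sum, ha1, hb1, mul_one, mul_one,
        htu]
    · simp only [add_smul, mul_smul, Finset.sum_add_distrib, ← Finset.smul_sum, hax, hbx,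
        Prod.fst_add, Prod.smul_fst]
    · rw [hlin]
      exact add_le_add (mul_le_mul_of_nonneg_left haL ht) (mul_le_mul_of_nonneg_left hbL hu)
    · rw [hlin]
      exact add_le_add (mul_le_mul_of_nonneg_left haU ht) (mul_le_mul_of_nonneg_left hbU hu)

theorem BoundingSet.mem_polyhedron_of_weights (B : BoundingSet n) {s : Finset (Pt n)}
    {a : Pt n → ℝ} (ha : ∀ v ∈ s, 0 ≤ a v) (ha1 : ∑ v ∈ s, a v = 1) {y : ℝ}
    (hL : ∑ v ∈ s, a v * B.L v ≤ y) (hU : y ≤ ∑ v ∈ s, a v * B.U v) :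
    (∑ v ∈ s, a v • v, y) ∈ B.polyhedron s := by
  have hconv : Convex ℝ (B.polyhedron s) := convex_convexHull ℝ _
  have hpt : ∀ g : Pt n → ℝ, (∀ v ∈ s, (v, g v) ∈ B.polyhedron s) →
      (∑ v ∈ s, a v • v, ∑ v ∈ s, a v * g v) ∈ B.polyhedron s := fun g hg => by
    have := hconv.sum_mem ha ha1 hg
    have heq : ∑ v ∈ s, a v • (v, g v) = (∑ v ∈ s, a v • v, ∑ v ∈ s, a v * g v) :=
      Prod.ext (by simp [Prod.fst_sum]) (by simp [Prod.snd_sum])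
    rwa [heq] at this
  -- The vertical fibre is convex, so it contains everything between the interpolations of `L` and
  -- `U`.
  have hfib : Convex ℝ {y : ℝ | (∑ v ∈ s, a v • v, y) ∈ B.polyhedron s} := by
    intro y hy y' hy' t u ht hu htu
    have := hconv hy hy' ht hu htu
    rwa [Prod.smul_mk, Prod.smul_mk, Prod.mk_add_mk, ← add_smul, htu, one_smul] at this
  exact hfib.ordConnected.out
    (hpt _ fun v hv => subset_convexHull ℝ _ (Or.inl ⟨v, hv, rfl⟩))
    (hpt _ fun v hv => subset_convexHull ℝ _ (Or.inr ⟨v, hv, rfl⟩)) ⟨hL, hU⟩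

end PolyEnc

end

/-! ### Enclosure by the refined bounding set -/

theorem mainTheorem1 {n : ℕ} (B : PolyEnc.BoundingSet n) (hB : PolyEnc.IsGrid B.points)
    {D : Set (PolyEnc.Pt n)} (f : D → ℝ) (hf : B.Encloses f)
    (Δ : Geometry.SimplicialComplex ℝ (PolyEnc.Pt n))
    (hΔ : PolyEnc.IsDelaunayTriangulation B.points Δ)
    (q : PolyEnc.Pt n) (hq : q ∈ B.dom) :
    (B.interp hB Δ hΔ q).Encloses f := by
  obtain ⟨hD, hf⟩ := hf
  have hdom : (B.interp hB Δ hΔ q).dom = B.dom := PolyEnc.convexHull_gridExpand hB hq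
  refine ⟨hdom.trans_subset hD, fun x hx Δ' hΔ' => ?_⟩
  obtain ⟨⟨s, θ⟩, hs, hθ, hθ1, hθx⟩ := hΔ'.exists_isConvexCoords hx
  dsimp only at hs hθ hθ1 hθx
  have hxB : x ∈ B.dom := hdom ▸ hx
  have hweights : ∀ Δ'', PolyEnc.IsDelaunayTriangulation B.points Δ'' →
      ∃ c, PolyEnc.IsConvexCoords Δ'' (∑ w ∈ s, θ w • w) c ∧
        ∑ v ∈ c.1, c.2 v * B.L v ≤ f ⟨x, hD hxB⟩ ∧
        f ⟨x, hD hxB⟩ ≤ ∑ v ∈ c.1, c.2 v * B.U v := by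
    intro Δ'' hΔ''
    obtain ⟨t, ht, hmem⟩ := Set.mem_iUnion₂.1 (hf x hxB Δ'' hΔ'')
    obtain ⟨a, ha, ha1, hax, hL, hU⟩ :=
      B.exists_weights_of_mem_polyhedron (hΔ''.subset_points ht.1) hmem
    exact ⟨(t, a), ⟨ht, ha, ha1, hax.trans hθx.symm⟩, hL, hU⟩
  have hne := Δ'.nonempty_of_mem_faces hs.1
  have hsP : s ⊆ PolyEnc.gridExpand B.points q := hΔ'.subset_points hs.1
  have hdel : PolyEnc.IsDelaunaySimplex (PolyEnc.gridExpand B.points q) s := hΔ'.delaunay s hs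
  refine Set.mem_biUnion hs ?_
  have hU := PolyEnc.le_sum_mul_interpFun hB B.fullDim hΔ hq hne hsP hdel hθ hθ1 B.U
    fun Δ'' hΔ'' => (hweights Δ'' hΔ'').imp fun c hc => ⟨hc.1, hc.2.2⟩
  -- The lower bound is the upper bound for `-L` and `-f x`.
  have hL := PolyEnc.le_sum_mul_interpFun hB B.fullDim hΔ hq hne hsP hdel hθ hθ1
    (fun p => -B.L p) (y := -f ⟨x, hD hxB⟩)
    fun Δ'' hΔ'' => (hweights Δ'' hΔ'').imp fun c hc => ⟨hc.1, by simpa using hc.2.1⟩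
  simp only [PolyEnc.interpFun_neg, mul_neg, Finset.sum_neg_distrib, neg_le_neg_iff] at hL
  have := (B.interp hB Δ hΔ q).mem_polyhedron_of_weights hθ hθ1 hL hU
  rwa [hθx] at this
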